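/- Let $f(\cdot;\theta_f):\mathbb{R}^d\to\mathbb{R}^d$ be a parametrized vector field and consider $h(t)=h(0)+\int_0^t f(h(s);\theta_f)\,ds$. Let $H\subseteq\mathbb{R}^d$ be a closed set (for instance a compact set, or $\mathbb{R}^d$), the state space, and let $c_1,\dots,c_L\in H$ be pairwise distinct points. Let $W_i(h)=W(h,c_i;\theta_W)$ be parametrized functions, let $D_{W_i}=\{h\in H: W_i(h)<1\}$ be the prescribed region of attraction of class $i$, let $\Phi_i$ be real functions on $D_{W_i}$, and define the consistency loss $$\mathcal{L}_{con}(\theta_f,\theta_W)=\sum_{i=1}^L\ \sup_{h\in D_{W_i}}\Big\|\frac{dW_i(h)}{dh}f(h;\theta_f)+\Phi_i(h)\,(1-W_i(h))\Big\|_2^2\in[0,\infty].$$ Let $\theta^*=(\theta_f,\theta_W)$ be parameters such that: 1. $f(\cdot;\theta_f)$ is Lipschitz continuous, and every solution that starts in $H$ stays in $H$ in forward time; 2. each $W_i$ is a continuous function $H\to[0,1]$, differentiable (relative to $H$) at the points of $D_{W_i}$, with $W_i(c_i)=0$, $W_i(h)>0$ for $h\in H\setminus\{c_i\}$, and $W_i(h)\to1$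 as $\|h\|\to\infty$ in $H$ (which is automatic if $H$ is compact); 3. each $\Phi_i$ is continuous on $D_{W_i}$, with $\Phi_i(c_i)=0$ and $\Phi_i(h)>0$ for $h\in D_{W_i}\setminus\{c_i\}$. If $\mathcal{L}_{con}(\theta^*)=0$, then $D_{W_i}\cap D_{W_j}=\emptyset$ for all $i\ne j$. -/

import Mathlib

open Set Filter Topology
open scoped ENNReal NNReal

noncomputable section

namespace ZubovNet

variable {E : Type*} [NormedAddCommGroup E] [NormedSpace ℝ E]

/-- `γ` solves the autonomous equation `γ t = γ 0 + ∫₀ᵗ f (γ s) ds` on `[0, T]`. -/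
def IsSolutionOn (f : E → E) (T : ℝ) (γ : ℝ → E) : Prop :=
  ContinuousOn γ (Icc 0 T) ∧ ∀ t ∈ Icc 0 T, γ t = γ 0 + ∫ s in (0 : ℝ)..t, f (γ s)

/-- `H` is a state space for the equation driven by `f`: solutions that start in `H`
have all their states in `H`. -/
def IsStateSpace (f : E → E) (H : Set E) : Prop :=
  ∀ (T : ℝ) (γ : ℝ → E), IsSolutionOn f T γ → γ 0 ∈ H → ∀ t ∈ Icc 0 T, γ t ∈ H

/-- `V` is positive definite on `S` with respect to the point `c`. -/
def PosDefAt (S : Set E) (c : E) (V : E → ℝ) : Prop :=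
  V c = 0 ∧ ∀ h ∈ S, h ≠ c → 0 < V h

/-- The prescribed region of attraction `D_W`: the strict sublevel-1 set of `W` in `H`. -/
def PRoA (H : Set E) (W : E → ℝ) : Set E :=
  {h ∈ H | W h < 1}

/-- `W : H → [0, 1]` is a (Zubov-type) Lyapunov function for the point `c`. -/
structure IsLyapunov (H : Set E) (c : E) (W : E → ℝ) : Prop where
  mem : c ∈ H
  mapsTo : MapsTo W H (Icc 0 1)
  continuousOn : ContinuousOn W H
  differentiable : ∀ h ∈ PRoA H W, DifferentiableWithinAt ℝ W H h
  posDef : PosDefAt H c W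
  /-- `W h → 1` as `‖h‖ → ∞` in `H`; this is automatic when `H` is bounded. -/
  tendsto_one : Tendsto W (Bornology.cobounded E ⊓ 𝓟 H) (𝓝 1)

/-- The pointwise consistency loss `‖(dW/dh) f(h) + Φ(h) (1 - W(h))‖²`. -/
def pointLoss (H : Set E) (f : E → E) (W Φ : E → ℝ) (h : E) : ℝ :=
  ‖fderivWithin ℝ W H h (f h) + Φ h * (1 - W h)‖ ^ 2

/-- The consistency loss `∑ᵢ sup_{h ∈ D_{Wᵢ}} lᵢ(h)` with `Wᵢ = W(·, cᵢ; θW)`, as a function of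
`(θf, θW)`. It takes values in `[0, ∞]`, so that an unbounded supremum is `∞`. -/
def consistencyLoss {ΘF ΘW : Type*} {L : ℕ} (H : Set E) (c : Fin L → E) (Φ : Fin L → E → ℝ)
    (f : E → ΘF → E) (W : E → E → ΘW → ℝ) (θf : ΘF) (θW : ΘW) : ℝ≥0∞ :=
  ∑ i, ⨆ h ∈ PRoA H (fun h => W h (c i) θW),
    ENNReal.ofReal (pointLoss H (fun h => f h θf) (fun h => W h (c i) θW) (Φ i) h)

end ZubovNet

end

namespace ZubovNet

/-! Zero loss means that `W` has derivative `-Φ (1 - W) ≤ 0` along solutions in its region. If `x`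
lay in two regions, the set where `W ≤ W x` and `W' ≤ W' x` would be compact, and solutions could
not leave it (`IsLyapunov.comp_le_of_pointLoss_eq_zero`). Start a solution at a minimiser of `W +
W'` on this set: the right derivative of the sum at time `0` is nonnegative by minimality, yet
negative because the minimiser differs from `c` or from `c'`. A short-time solution suffices; no
convergence to an equilibrium is used. -/

theorem PosDefAt.nonneg {E : Type*} {c : E} {S : Set E} {V : E → ℝ} (hV : PosDefAt S c V) {h : E} (hh : h ∈ S) :
    0 ≤ V h := by
  by_cases hc : h = c
  · rw [hc, hV.1]
  · exact (hV.2 h hh hc).le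

section

variable {E : Type*} [NormedAddCommGroup E] [NormedSpace ℝ E]
  {f : E → E} {H : Set E} {W Φ : E → ℝ} {c : E} {τ : ℝ} {γ : ℝ → E}

/-- A Lipschitz autonomous equation has a solution, in differential form, on a short interval. -/
theorem exists_hasDerivWithinAt_of_lipschitzWith [CompleteSpace E] {K : ℝ≥0}
    (hf : LipschitzWith K f) (x : E) :
    ∃ τ > 0, ∃ γ : ℝ → E, γ 0 = x ∧
      ∀ t ∈ Icc 0 τ, HasDerivWithinAt γ (f (γ t)) (Icc 0 τ) t := by
  -- `M` bounds `‖f‖` on the unit ball around `x`. In time `1 / (M + 1)` a solution travels at most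
  -- distance `1`; the `+ 1` avoids division by zero.
  set M : ℝ≥0 := ‖f x‖₊ + K
  have hM : (0 : ℝ) < M + 1 := by positivity
  have hτ : (0 : ℝ) < 1 / (M + 1) := by positivity
  have hpl : IsPicardLindelof (fun _ ↦ f) (⟨0, le_rfl, hτ.le⟩ : Icc (0 : ℝ) (1 / (M + 1)))
      x 1 0 M K := by
    refine .of_time_independent (fun y hy ↦ ?_) hf.lipschitzOnWith ?_
    · have h₁ := hf.dist_le_mul y x
      have h₂ : dist y x ≤ 1 := by simpa using hy
      have h₃ : ‖f y‖ ≤ ‖f x‖ + dist (f y) (f x) := by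
        rw [dist_eq_norm]; exact norm_le_norm_add_norm_sub' _ _
      have h₄ : (K : ℝ) * dist y x ≤ K := mul_le_of_le_one_right K.2 h₂
      simp only [M, NNReal.coe_add, coe_nnnorm]
      linarith
    · simp only [sub_zero, sub_self, NNReal.coe_one, NNReal.coe_zero]
      rw [max_eq_left hτ.le, mul_one_div, div_le_one hM]
      linarith
  obtain ⟨γ, h₀, hγ⟩ := hpl.exists_eq_forall_mem_Icc_hasDerivWithinAt₀
  exact ⟨_, hτ, γ, h₀, hγ⟩

/-- A differentiable solution satisfies the integral equation. -/
theorem isSolutionOn_of_hasDerivWithinAt [CompleteSpace E] (hf : Continuous f)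
    (hγ : ∀ t ∈ Icc 0 τ, HasDerivWithinAt γ (f (γ t)) (Icc 0 τ) t) : IsSolutionOn f τ γ := by
  have hcont : ContinuousOn γ (Icc 0 τ) := fun t ht ↦ (hγ t ht).continuousWithinAt
  refine ⟨hcont, fun t ht ↦ ?_⟩
  have hsub : Icc 0 t ⊆ Icc 0 τ := Icc_subset_Icc_right ht.2
  rw [intervalIntegral.integral_eq_sub_of_hasDerivAt_of_le ht.1 (hcont.mono hsub)
    (fun s hs ↦ (hγ s (hsub (Ioo_subset_Icc_self hs))).hasDerivAt
      (Icc_mem_nhds hs.1 (hs.2.trans_le ht.2)))]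
  · abel
  · refine ContinuousOn.intervalIntegrable ?_
    rw [uIcc_of_le ht.1]
    exact hf.comp_continuousOn (hcont.mono hsub)

/-- The sublevel sets of a Lyapunov function at levels below `1` are compact. -/
theorem IsLyapunov.isCompact_sublevel [ProperSpace E] (hH : IsClosed H) (hW : IsLyapunov H c W)
    {a : ℝ} (ha : a < 1) : IsCompact {h ∈ H | W h ≤ a} := by
  refine Metric.isCompact_of_isClosed_isBounded ?_ ?_
  · exact hW.continuousOn.preimage_isClosed_of_isClosed hH isClosed_Iic
  · have h := hW.tendsto_one.eventually (lt_mem_nhds ha)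
    rw [eventually_inf_principal] at h
    refine Bornology.isBounded_def.2 (mem_of_superset h fun x hx hx' ↦ ?_)
    exact absurd (hx hx'.1) (not_lt.2 hx'.2)

/-- Where the pointwise loss vanishes, the Zubov equation gives the right derivative of `W` along
solutions that remain in `H`. -/
theorem hasDerivWithinAt_comp_of_pointLoss_eq_zero (hW : IsLyapunov H c W)
    (hγ : ∀ t ∈ Icc 0 τ, HasDerivWithinAt γ (f (γ t)) (Icc 0 τ) t)
    (hmem : ∀ t ∈ Icc 0 τ, γ t ∈ H) {t : ℝ} (ht : t ∈ Ico 0 τ) (hlt : W (γ t) < 1)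
    (hloss : pointLoss H f W Φ (γ t) = 0) :
    HasDerivWithinAt (W ∘ γ) (-(Φ (γ t) * (1 - W (γ t)))) (Ici t) t := by
  have ht' := Ico_subset_Icc_self ht
  -- The chain rule holds for any choice of derivative relative to `H`, so `H` need not have unique
  -- derivatives.
  have h := (hW.differentiable _ ⟨hmem t ht', hlt⟩).hasFDerivWithinAt.comp_hasDerivWithinAt t
    (hγ t ht') hmem
  have heq : fderivWithin ℝ W H (γ t) (f (γ t)) = -(Φ (γ t) * (1 - W (γ t))) :=
    eq_neg_of_add_eq_zero_left (norm_eq_zero.1 (pow_eq_zero_iff two_ne_zero |>.1 hloss))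
  rw [heq] at h
  refine h.mono_of_mem_nhdsWithin ?_
  exact mem_of_superset (Icc_mem_nhdsGE ht.2) (Icc_subset_Icc_left ht.1)

/-- Along a solution that starts in the prescribed region of attraction, `W` does not exceed its
initial value. -/
theorem IsLyapunov.comp_le_of_pointLoss_eq_zero (hW : IsLyapunov H c W)
    (hΦ : PosDefAt (PRoA H W) c Φ) (hloss : ∀ h ∈ PRoA H W, pointLoss H f W Φ h = 0)
    (hγ : ∀ t ∈ Icc 0 τ, HasDerivWithinAt γ (f (γ t)) (Icc 0 τ) t)
    (hmem : ∀ t ∈ Icc 0 τ, γ t ∈ H) (h₀ : W (γ 0) < 1) {t : ℝ} (ht : t ∈ Icc 0 τ) :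
    W (γ t) ≤ W (γ 0) := by
  have hcont : ContinuousOn (W ∘ γ) (Icc 0 τ) :=
    hW.continuousOn.comp (fun s hs ↦ (hγ s hs).continuousWithinAt) hmem
  by_contra! hlt
  -- Taking `m < 1` keeps the solution inside the region, where the Zubov equation is available,
  -- until the first time `s` at which `W` reaches `m`.
  obtain ⟨m, hm₀, hm⟩ := exists_between (lt_min h₀ hlt)
  obtain ⟨hm₁, hmt⟩ := lt_min_iff.1 hm
  have hcompact : IsCompact (Icc 0 τ ∩ (W ∘ γ) ⁻¹' Ici m) :=
    isCompact_Icc.of_isClosed_subset (hcont.preimage_isClosed_of_isClosed isClosed_Icc isClosed_Ici)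
      inter_subset_left
  obtain ⟨s, ⟨hs, hms⟩, hleast⟩ := hcompact.exists_isLeast ⟨t, ht, hmt.le⟩
  have hbelow : ∀ r ∈ Ico 0 s, W (γ r) < m := fun r hr ↦ by
    by_contra! hle
    exact absurd (hleast ⟨⟨hr.1, hr.2.le.trans hs.2⟩, hle⟩) (not_le.2 hr.2)
  have hroa : ∀ r ∈ Ico 0 s, γ r ∈ PRoA H W := fun r hr ↦
    ⟨hmem r ⟨hr.1, hr.2.le.trans hs.2⟩, (hbelow r hr).trans hm₁⟩
  have hle := image_le_of_deriv_right_le_deriv_boundary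
    (hcont.mono (Icc_subset_Icc_right hs.2))
    (fun r hr ↦ hasDerivWithinAt_comp_of_pointLoss_eq_zero hW hγ hmem
      ⟨hr.1, hr.2.trans_le hs.2⟩ (hroa r hr).2 (hloss _ (hroa r hr)))
    (B := fun _ ↦ W (γ 0)) le_rfl continuousOn_const
    (fun r _ ↦ hasDerivWithinAt_const r (Ici r) (W (γ 0)))
    (fun r hr ↦ neg_nonpos.2 (mul_nonneg (hΦ.nonneg (hroa r hr)) (sub_nonneg.2 (hroa r hr).2.le)))
    (right_mem_Icc.2 hs.1)
  exact absurd (hm₀.trans_le hms) (not_lt.2 hle)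

/-- A function that is minimal at the left endpoint has nonnegative right derivative there. -/
theorem nonneg_of_hasDerivWithinAt_Ici {u : ℝ → ℝ} {u' a b : ℝ} (hab : a < b)
    (hu : HasDerivWithinAt u u' (Ici a) a) (hmin : ∀ t ∈ Icc a b, u a ≤ u t) : 0 ≤ u' := by
  rw [hasDerivWithinAt_iff_tendsto_slope, Ici_sdiff_left] at hu
  refine ge_of_tendsto hu ?_
  filter_upwards [Ioc_mem_nhdsGT hab] with t ht
  rw [slope_def_field]
  exact div_nonneg (sub_nonneg.2 (hmin t (Ioc_subset_Icc_self ht))) (sub_nonneg.2 ht.1.le)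

/-- The prescribed regions of attraction of two distinct points, for two Lyapunov functions that
satisfy the Zubov equation of the same vector field, are disjoint: otherwise the sum of the two
functions would be strictly decreasing along solutions at its minimum over a compact invariant
set. -/
theorem disjoint_PRoA [ProperSpace E] {c' : E} {W' Φ' : E → ℝ}
    (hH : IsClosed H) (hf : ∃ K : ℝ≥0, LipschitzWith K f) (hinv : IsStateSpace f H)
    (hcc' : c ≠ c') (hW : IsLyapunov H c W) (hW' : IsLyapunov H c' W')
    (hΦ : PosDefAt (PRoA H W) c Φ) (hΦ' : PosDefAt (PRoA H W') c' Φ')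
    (hloss : ∀ h ∈ PRoA H W, pointLoss H f W Φ h = 0)
    (hloss' : ∀ h ∈ PRoA H W', pointLoss H f W' Φ' h = 0) :
    Disjoint (PRoA H W) (PRoA H W') := by
  rw [Set.disjoint_left]
  rintro x ⟨hxH, hx⟩ ⟨-, hx'⟩
  obtain ⟨K, hK⟩ := hf
  have hcompact := (hW.isCompact_sublevel hH hx).inter (hW'.isCompact_sublevel hH hx')
  obtain ⟨y, ⟨⟨hyH, hy⟩, -, hy'⟩, hmin⟩ := hcompact.exists_isMinOn
    ⟨x, ⟨hxH, le_rfl⟩, hxH, le_rfl⟩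
    ((hW.continuousOn.add hW'.continuousOn).mono fun z hz ↦ hz.1.1)
  have hyD : y ∈ PRoA H W := ⟨hyH, hy.trans_lt hx⟩
  have hyD' : y ∈ PRoA H W' := ⟨hyH, hy'.trans_lt hx'⟩
  obtain ⟨τ, hτ, γ, rfl, hγ⟩ := exists_hasDerivWithinAt_of_lipschitzWith hK y
  have hmem := hinv τ γ (isSolutionOn_of_hasDerivWithinAt hK.continuous hγ) hyH
  have h₀ : (0 : ℝ) ∈ Ico 0 τ := ⟨le_rfl, hτ⟩
  have hderiv :=
    (hasDerivWithinAt_comp_of_pointLoss_eq_zero hW hγ hmem h₀ hyD.2 (hloss _ hyD)).add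
      (hasDerivWithinAt_comp_of_pointLoss_eq_zero hW' hγ hmem h₀ hyD'.2 (hloss' _ hyD'))
  have hnonneg := nonneg_of_hasDerivWithinAt_Ici hτ hderiv fun t ht ↦
    hmin ⟨⟨hmem t ht, (hW.comp_le_of_pointLoss_eq_zero hΦ hloss hγ hmem hyD.2 ht).trans hy⟩,
      hmem t ht, (hW'.comp_le_of_pointLoss_eq_zero hΦ' hloss' hγ hmem hyD'.2 ht).trans hy'⟩
  have hp : 0 ≤ Φ (γ 0) * (1 - W (γ 0)) :=
    mul_nonneg (hΦ.nonneg hyD) (sub_nonneg.2 hyD.2.le)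
  have hp' : 0 ≤ Φ' (γ 0) * (1 - W' (γ 0)) :=
    mul_nonneg (hΦ'.nonneg hyD') (sub_nonneg.2 hyD'.2.le)
  -- Since `c ≠ c'`, at least one of the two decay rates is strictly positive.
  by_cases hc : γ 0 = c
  · have := mul_pos (hΦ'.2 _ hyD' (hc ▸ hcc')) (sub_pos.2 hyD'.2)
    linarith
  · have := mul_pos (hΦ.2 _ hyD hc) (sub_pos.2 hyD.2)
    linarith

/-- If the consistency loss vanishes, so does every pointwise loss on the corresponding prescribed
region of attraction. -/
theorem pointLoss_eq_zero_of_consistencyLoss_eq_zero {ΘF ΘW : Type*} {L : ℕ} {c : Fin L → E}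
    {Φ : Fin L → E → ℝ} {f : E → ΘF → E} {W : E → E → ΘW → ℝ} {θf : ΘF} {θW : ΘW}
    (hloss : consistencyLoss H c Φ f W θf θW = 0) (i : Fin L) :
    ∀ h ∈ PRoA H (fun h ↦ W h (c i) θW),
      pointLoss H (fun h ↦ f h θf) (fun h ↦ W h (c i) θW) (Φ i) h = 0 := by
  intro h hh
  have hi := (Finset.sum_eq_zero_iff.1 hloss) i (Finset.mem_univ i)
  simp only [ENNReal.iSup_eq_zero, ENNReal.ofReal_eq_zero] at hi
  exact le_antisymm (hi h hh) (sq_nonneg _)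

end

end ZubovNet

theorem proposition4 {d L : ℕ} {ΘF ΘW : Type*}
    (H : Set (EuclideanSpace ℝ (Fin d))) (hH : IsClosed H)
    (c : Fin L → EuclideanSpace ℝ (Fin d)) (hc : Function.Injective c)
    (f : EuclideanSpace ℝ (Fin d) → ΘF → EuclideanSpace ℝ (Fin d))
    (W : EuclideanSpace ℝ (Fin d) → EuclideanSpace ℝ (Fin d) → ΘW → ℝ)
    (Φ : Fin L → EuclideanSpace ℝ (Fin d) → ℝ)
    (θf : ΘF) (θW : ΘW)
    (hf : ∃ K : ℝ≥0, LipschitzWith K (fun h => f h θf))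
    (hinv : ZubovNet.IsStateSpace (fun h => f h θf) H)
    (hW : ∀ i, ZubovNet.IsLyapunov H (c i) (fun h => W h (c i) θW))
    (hΦc : ∀ i, ContinuousOn (Φ i) (ZubovNet.PRoA H (fun h => W h (c i) θW)))
    (hΦ : ∀ i, ZubovNet.PosDefAt (ZubovNet.PRoA H (fun h => W h (c i) θW)) (c i) (Φ i))
    (hloss : ZubovNet.consistencyLoss H c Φ f W θf θW = 0) :
    ∀ i j, i ≠ j →
      ZubovNet.PRoA H (fun h => W h (c i) θW) ∩ ZubovNet.PRoA H (fun h => W h (c j) θW) = ∅ := by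
  intro i j hij
  exact Set.disjoint_iff_inter_eq_empty.1 <|
    ZubovNet.disjoint_PRoA hH hf hinv (hc.ne hij) (hW i) (hW j) (hΦ i) (hΦ j)
      (ZubovNet.pointLoss_eq_zero_of_consistencyLoss_eq_zero hloss i)
      (ZubovNet.pointLoss_eq_zero_of_consistencyLoss_eq_zero hloss j)
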